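/- Let $A\in\mathbb{R}^{n\times n}$ be symmetric with all eigenvalues in $[0,2c]$, $c>0$, let $g,v\in\mathbb{R}^n$ with $\beta:=\|g-Av\|=1$ ($\|\cdot\|$ the Euclidean norm), and let $t\ge 0$. For an integer $k\ge 1$ let $V_k=[v_1\ \dots\ v_k]\in\mathbb{R}^{n\times k}$ be the matrix of the vectors produced by $k$ steps of the Arnoldi process for $A$ with starting vector $g-Av$ (Gram–Schmidt orthonormalization, $v_1=(g-Av)/\|g-Av\|$; $v_{j+1}$ is the normalization of $w_j:=Av_j-\sum_{i\le j}(v_i^TAv_j)v_i$; if the process terminates, i.e. some $w_j=0$, all further vectors are set to $0$), and let $H_k=V_k^TAV_k$. With the entire function $\varphi(z)=(e^z-1)/z$, $\varphi(0)=1$, and $e_1=(1,0,\dots,0)^T\in\mathbb{R}^k$, let $$y_k(t)=v+V_k\,t\,\varphi(-tH_k)(\beta e_1)$$ be the Krylov subspace approximation to the solution of $y'=-Ay+g$, $y(0)=v$, and let $$r_k(t)=-Ay_k(t)+g-y_k'(t)$$ be its residual. Proposition P3 (bound for $k$ of order at least $ct$, symmetric case). If $k\ge\max\{5ct,2\}$,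 then $y_k$ is differentiable at $t$ and $$\|r_k(t)\|\le\frac{16\,(ct)^k}{(2k-1)!!}.$$ -/

import Mathlib

open scoped Matrix Nat

noncomputable section

namespace KrylovPhi

/-- The entire function `φ(z) = (e^z - 1) / z`, `φ(0) = 1`, evaluated at an element `x` of a real
topological algebra (for instance a number or a square matrix) through its Taylor series
`φ(x) = ∑_{j ≥ 0} x^j / (j+1)!`. -/
def phi {R : Type*} [Ring R] [Algebra ℝ R] [TopologicalSpace R] (x : R) : R :=
  ∑' j : ℕ, (((j + 1)! : ℕ) : ℝ)⁻¹ • x ^ j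

/-- The Taylor series of `φ` converges absolutely in every complete normed algebra. -/
theorem summable_phi {R : Type*} [NormedRing R] [NormedAlgebra ℝ R] [CompleteSpace R] (x : R) :
    Summable fun j : ℕ => (((j + 1)! : ℕ) : ℝ)⁻¹ • x ^ j := by
  have h := NormedSpace.norm_expSeries_summable' (𝕂 := ℝ) x
  refine Summable.of_norm_bounded h fun j => ?_
  rw [norm_smul, norm_smul]
  refine mul_le_mul_of_nonneg_right ?_ (norm_nonneg _)
  rw [norm_inv, norm_inv, Real.norm_natCast, Real.norm_natCast]
  have h1 : (0 : ℝ) < ((j ! : ℕ) : ℝ) := by exact_mod_cast Nat.factorial_pos j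
  have h2 : ((j ! : ℕ) : ℝ) ≤ (((j + 1)! : ℕ) : ℝ) := by
    exact_mod_cast Nat.factorial_le (Nat.le_succ j)
  exact inv_anti₀ h1 h2

/-- The Taylor series of `φ` converges at every real square matrix. -/
theorem hasSum_phi_matrix {k : ℕ} (M : Matrix (Fin k) (Fin k) ℝ) :
    HasSum (fun j : ℕ => (((j + 1)! : ℕ) : ℝ)⁻¹ • M ^ j) (phi M) := by
  let _ : NormedRing (Matrix (Fin k) (Fin k) ℝ) := Matrix.linftyOpNormedRing
  let _ : NormedAlgebra ℝ (Matrix (Fin k) (Fin k) ℝ) := Matrix.linftyOpNormedAlgebra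
  exact (summable_phi M).hasSum

/-- For complex numbers `phi` is the function `(e^z - 1) / z`, continued by `1` to `z = 0`. -/
theorem phi_complex (z : ℂ) : phi z = if z = 0 then 1 else (Complex.exp z - 1) / z := by
  have hs := (summable_phi z).hasSum
  change HasSum _ (phi z) at hs
  split_ifs with hz
  · subst hz
    refine hs.unique ?_
    have h := hasSum_single (f := fun j : ℕ => (((j + 1)! : ℕ) : ℝ)⁻¹ • (0 : ℂ) ^ j) 0
      (fun j hj => by simp [hj])
    simpa using h
  · have h1 : HasSum (fun j : ℕ => (((j ! : ℕ) : ℝ))⁻¹ • z ^ j) (Complex.exp z) := by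
      have h := NormedSpace.exp_series_hasSum_exp' (𝕂 := ℝ) z
      rwa [← Complex.exp_eq_exp_ℂ] at h
    have h2 := (hasSum_nat_add_iff' 1).mpr h1
    have h3 := hs.mul_left z
    have h4 : z * phi z = Complex.exp z - 1 := by
      refine h3.unique ?_
      have h5 : (fun j : ℕ => z * ((((j + 1)! : ℕ) : ℝ)⁻¹ • z ^ j)) =
          fun j : ℕ => (((j + 1)! : ℕ) : ℝ)⁻¹ • z ^ (j + 1) := by
        funext j
        rw [pow_succ', mul_smul_comm]
      rw [h5]
      simpa using h2
    rw [← h4, mul_div_cancel_left₀ _ hz]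

/-- The Euclidean norm on `ℝⁿ`. -/
def norm2 {n : ℕ} (x : Fin n → ℝ) : ℝ := ‖WithLp.toLp 2 x‖

/-- The basis vectors `v₁, v₂, …` (numbered from `0`) of the Arnoldi process for the matrix `A` and
the starting vector `b`: `v₁ = b / ‖b‖`, and `v_{j+1} = w / ‖w‖` with
`w = A v_j - ∑_{i ≤ j} (v_iᵀ A v_j) v_i`, so `h_{j+1,j} = ‖w‖`.
If the process terminates (`w = 0`) then all further vectors are `0`; this does not change
the Krylov approximation below any more. -/
def arnoldiVec {n : ℕ} (A : Matrix (Fin n) (Fin n) ℝ) (b : Fin n → ℝ) : ℕ → Fin n → ℝ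
  | 0 => (norm2 b)⁻¹ • b
  | j + 1 =>
    let w : Fin n → ℝ := A *ᵥ arnoldiVec A b j -
      ∑ i : Fin (j + 1),
        (arnoldiVec A b (i : ℕ) ⬝ᵥ (A *ᵥ arnoldiVec A b j)) • arnoldiVec A b (i : ℕ)
    (norm2 w)⁻¹ • w
  termination_by j => j
  decreasing_by all_goals omega

/-- `V_k = [v₁ … v_k] ∈ ℝ^{n × k}`. -/
def arnoldiV {n : ℕ} (A : Matrix (Fin n) (Fin n) ℝ) (b : Fin n → ℝ) (k : ℕ) :
    Matrix (Fin n) (Fin k) ℝ :=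
  Matrix.of fun i j => arnoldiVec A b (j : ℕ) i

/-- `H_k = V_kᵀ A V_k ∈ ℝ^{k × k}`. -/
def arnoldiH {n : ℕ} (A : Matrix (Fin n) (Fin n) ℝ) (b : Fin n → ℝ) (k : ℕ) :
    Matrix (Fin k) (Fin k) ℝ :=
  (arnoldiV A b k)ᵀ * A * arnoldiV A b k

/-- `e₁ = (1, 0, …, 0)ᵀ ∈ ℝ^k`. -/
def e1 (k : ℕ) : Fin k → ℝ := fun i => if (i : ℕ) = 0 then 1 else 0

/-- The Krylov subspace approximation after `k` Arnoldi steps to the solution of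
`y' = -A y + g`, `y(0) = v`:
`y_k(t) = v + V_k (t φ(-t H_k) (β e₁))`, where `V_k`, `H_k` come from the Arnoldi process
started with `g - A v`, and `β = ‖g - A v‖`. -/
def krylovApprox {n : ℕ} (A : Matrix (Fin n) (Fin n) ℝ) (g v : Fin n → ℝ) (k : ℕ) (t : ℝ) :
    Fin n → ℝ :=
  v + arnoldiV A (g - A *ᵥ v) k *ᵥ
    (t • (phi (-t • arnoldiH A (g - A *ᵥ v) k) *ᵥ (norm2 (g - A *ᵥ v) • e1 k)))

/-- The residual `r_k(t) = -A y_k(t) + g - y_k'(t)`. -/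
def krylovResidual {n : ℕ} (A : Matrix (Fin n) (Fin n) ℝ) (g v : Fin n → ℝ) (k : ℕ) (t : ℝ) :
    Fin n → ℝ :=
  -(A *ᵥ krylovApprox A g v k t) + g - deriv (krylovApprox A g v k) t

end KrylovPhi

end

/-! The Arnoldi relation `A V = V H + w eₖᵀ` makes the residual a multiple of a single vector:
`r_k(t) = -(eₖᵀ t φ(-tH) e₁) w`, with `w` the last unnormalized Arnoldi vector
(`krylovResidual_eq`). Here `‖w‖ ≤ c`, because `w` is orthogonal to the preceding Arnoldi vector, so
`A` may be replaced by `A - cI`, of norm at most `c` (`norm2_arnoldiResid_le`).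

The scalar is the integral over `[0, t]` of the corner entry of `e^{-sH}`. As `H` is Hessenberg, the
corner entry of `p(H)` vanishes when `deg p < k - 1`. As `H` is symmetric with eigenvalues in `[0,
2c]`, the corner entry of `e^{-sH}` is at most the uniform error of such a `p` against `e^{-sx}`
there. Chebyshev interpolation gives `(sc)^(k-1) / (2^(k-2) (k-1)!)` (`abs_sum_exp_le`). Integrating
and multiplying by `c` yields `4 (ct)^k / (2^k k!)`, and `2^k k! = (2k)‼ ≥ (2k-1)‼`.

Functions of `H` are written as sums over an orthonormal eigenbasis, so the matrix exponential
itself never appears. -/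

noncomputable section

namespace KrylovPhi

open Polynomial

/-! ### Chebyshev interpolation of the exponential -/

/-- Iterated Rolle: a function with at least `m + 1` zeros in an interval has an `m`-th derivative
with a zero in that interval. -/
theorem exists_iteratedDeriv_eq_zero {a b : ℝ} (m : ℕ) :
    ∀ (f : ℝ → ℝ), ContDiff ℝ m f → ∀ S : Finset ℝ, S.card = m + 1 →
      (∀ x ∈ S, x ∈ Set.Icc a b ∧ f x = 0) → ∃ ξ ∈ Set.Icc a b, iteratedDeriv m f ξ = 0 := by
  induction m with
  | zero =>
    intro f _ S hS h
    obtain ⟨x, hx⟩ := Finset.card_pos.mp (by omega : 0 < S.card)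
    exact ⟨x, (h x hx).1, by simpa using (h x hx).2⟩
  | succ m ih =>
    intro f hf S hS h
    have hfd : ContDiff ℝ m (deriv f) := by
      rw [Nat.cast_succ] at hf
      exact (contDiff_succ_iff_deriv.mp hf).2.2
    let e := S.orderEmbOfFin hS
    have hlt : ∀ i : Fin (m + 1), e i.castSucc < e i.succ := fun i =>
      e.strictMono i.castSucc_lt_succ
    have hR : ∀ i : Fin (m + 1), ∃ c ∈ Set.Ioo (e i.castSucc) (e i.succ), deriv f c = 0 := by
      intro i
      refine exists_deriv_eq_zero (hlt i) hf.continuous.continuousOn ?_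
      rw [(h _ (S.orderEmbOfFin_mem hS _)).2, (h _ (S.orderEmbOfFin_mem hS _)).2]
    choose d hd hd0 using hR
    have hmono : StrictMono d := by
      refine Fin.strictMono_iff_lt_succ.mpr ?_
      intro i
      calc d i.castSucc < e i.castSucc.succ := (hd _).2
        _ = e i.succ.castSucc := by rw [Fin.succ_castSucc]
        _ < d i.succ := (hd _).1
    obtain ⟨ξ, hξ, hξ0⟩ := ih (deriv f) hfd (Finset.univ.map ⟨d, hmono.injective⟩) (by simp) (by
      intro x hx
      obtain ⟨i, -, rfl⟩ := Finset.mem_map.mp hx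
      refine ⟨⟨?_, ?_⟩, hd0 i⟩
      · exact (h _ (S.orderEmbOfFin_mem hS _)).1.1.trans (hd i).1.le
      · exact (hd i).2.le.trans (h _ (S.orderEmbOfFin_mem hS _)).1.2)
    exact ⟨ξ, hξ, by rwa [iteratedDeriv_succ']⟩

theorem iteratedDeriv_polynomial (p : ℝ[X]) (m : ℕ) :
    iteratedDeriv m (fun x => p.eval x) = fun x => (derivative^[m] p).eval x := by
  induction m generalizing p with
  | zero => simp
  | succ m ih =>
    rw [iteratedDeriv_succ', Function.iterate_succ_apply, ← ih]
    congr 1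
    funext x
    exact p.deriv

theorem iterate_derivative_eq_C_of_natDegree_le (p : ℝ[X]) (m : ℕ) (hp : p.natDegree ≤ m) :
    derivative^[m] p = C (m ! * p.coeff m) := by
  rw [eq_C_of_natDegree_le_zero (p := derivative^[m] p)
    ((natDegree_iterate_derivative p m).trans (by omega)), coeff_iterate_derivative]
  simp [Nat.descFactorial_self]

/-- Error formula of Lagrange interpolation, as a bound. -/
theorem exists_interpolation_error_le {a b M : ℝ} (m : ℕ) (f : ℝ → ℝ) (hf : ContDiff ℝ m f)
    (hM : ∀ ξ ∈ Set.Icc a b, |iteratedDeriv m f ξ| ≤ M) (S : Finset ℝ) (hS : S.card = m)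
    (hSI : ∀ x ∈ S, x ∈ Set.Icc a b) :
    ∃ p : ℝ[X], p.degree < m ∧ ∀ x ∈ Set.Icc a b,
      |f x - p.eval x| ≤ M / m ! * |(Lagrange.nodal S id).eval x| := by
  have hinj : Set.InjOn (id : ℝ → ℝ) S := Function.injective_id.injOn
  set p := Lagrange.interpolate S id f with hp
  have hdeg : p.degree < m := hS ▸ Lagrange.degree_interpolate_lt f hinj
  have hnode : ∀ x ∈ S, p.eval x = f x := fun x hx =>
    Lagrange.eval_interpolate_at_node f hinj hx
  refine ⟨p, hdeg, fun x hx => ?_⟩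
  set W := Lagrange.nodal S (id : ℝ → ℝ) with hW
  have hWS : ∀ y ∈ S, W.eval y = 0 := fun y hy =>
    Lagrange.eval_nodal_at_node (v := (id : ℝ → ℝ)) hy
  by_cases hxS : x ∈ S
  · simp [hnode x hxS, hWS x hxS]
  have hWx : W.eval x ≠ 0 := Lagrange.eval_nodal_not_at_node fun i hi h => hxS (by
    rw [h]; exact hi)
  have hWdeg : W.natDegree = m := by rw [hW, Lagrange.natDegree_nodal, hS]
  -- With this `K` the function `f - (p + K W)` vanishes at `x` as well as at the `m` nodes, so its
  -- `m`-th derivative `f⁽ᵐ⁾ - m! K` has a zero.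
  set K := (f x - p.eval x) / W.eval x with hK
  set Q := p + C K * W with hQ
  have hQdeg : Q.natDegree ≤ m := by
    refine natDegree_add_le_of_degree_le (natDegree_le_of_degree_le hdeg.le) ?_
    exact (natDegree_C_mul_le _ _).trans hWdeg.le
  have hQcoeff : Q.coeff m = K := by
    have h1 : W.coeff m = 1 := by
      rw [← hWdeg]
      exact Lagrange.nodal_monic (s := S) (v := (id : ℝ → ℝ))
    rw [hQ, coeff_add, coeff_C_mul, coeff_eq_zero_of_degree_lt hdeg, h1, zero_add, mul_one]
  have hQc : ContDiff ℝ m fun y => Q.eval y := by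
    simpa using Polynomial.contDiff_aeval (𝕜 := ℝ) Q m
  obtain ⟨ξ, hξ, hξ0⟩ := exists_iteratedDeriv_eq_zero (a := a) (b := b) m
    (f - fun y => Q.eval y) (hf.sub hQc)
    (insert x S) (by rw [Finset.card_insert_of_notMem hxS, hS]) (by
      intro y hy
      rcases Finset.mem_insert.mp hy with rfl | hy
      · refine ⟨hx, ?_⟩
        simp only [Pi.sub_apply, hQ, eval_add, eval_mul, eval_C, hK]
        field_simp
        ring
      · refine ⟨hSI y hy, ?_⟩
        simp [hQ, hnode y hy, hWS y hy])
  rw [iteratedDeriv_sub hf.contDiffAt hQc.contDiffAt, iteratedDeriv_polynomial,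
    iterate_derivative_eq_C_of_natDegree_le Q m hQdeg, hQcoeff, sub_eq_zero] at hξ0
  simp only [eval_C] at hξ0
  have hm : (0 : ℝ) < m ! := by exact_mod_cast Nat.factorial_pos m
  have hKb : |K| ≤ M / m ! := by
    rw [le_div_iff₀ hm, mul_comm, ← abs_of_pos hm, ← abs_mul, ← hξ0]
    exact hM ξ hξ
  have hx' : f x - p.eval x = K * W.eval x := by rw [hK]; field_simp
  rw [hx', abs_mul]
  exact mul_le_mul_of_nonneg_right hKb (abs_nonneg _)

/-- Interpolation at the Chebyshev nodes on `[-1, 1]`. -/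
theorem exists_chebyshev_error_le {M : ℝ} (m : ℕ) (hm : m ≠ 0) (f : ℝ → ℝ) (hf : ContDiff ℝ m f)
    (hM : ∀ ξ ∈ Set.Icc (-1) 1, |iteratedDeriv m f ξ| ≤ M) :
    ∃ p : ℝ[X], p.degree < m ∧ ∀ x ∈ Set.Icc (-1) 1,
      |f x - p.eval x| ≤ M / (2 ^ (m - 1) * m !) := by
  set T := Chebyshev.T ℝ m with hT
  have hT0 : T ≠ 0 := Chebyshev.T_ne_zero ℝ _
  have hnd : T.roots.Nodup := by
    rw [hT, Chebyshev.roots_T_real m]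
    exact Finset.nodup _
  have hcard : Multiset.card T.roots = m := by
    rw [hT, Chebyshev.roots_T_real m, Finset.card_val, Finset.card_image_of_injOn
      ((Finset.range m).nodup_map_iff_injOn.mp (Chebyshev.roots_T_real_nodup m)), Finset.card_range]
  have hlead : T.leadingCoeff = 2 ^ (m - 1) := by
    rw [hT, Chebyshev.leadingCoeff_T]
    simp
  -- The monic nodal polynomial is `T / 2^(m-1)`, and `|T| ≤ 1` on `[-1, 1]`: this is the gain of
  -- `2^(m-1)`.
  have hprod : ∀ x, T.eval x = 2 ^ (m - 1) * (Lagrange.nodal T.roots.toFinset id).eval x := by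
    intro x
    have h1 := C_leadingCoeff_mul_prod_multiset_X_sub_C (p := T) (by
      rw [hcard, hT, Chebyshev.natDegree_T]; simp)
    rw [hlead] at h1
    have h2 : Lagrange.nodal T.roots.toFinset id = (T.roots.map fun a => X - C a).prod := by
      rw [Lagrange.nodal, Finset.prod_eq_multiset_prod, Multiset.toFinset_val, hnd.dedup]
      rfl
    rw [h2]
    conv_lhs => rw [← h1]
    simp
  obtain ⟨p, hp, h⟩ := exists_interpolation_error_le m f hf hM T.roots.toFinset
    (by rw [Multiset.toFinset_card_of_nodup hnd, hcard]) (by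
      intro x hx
      have hx' : T.eval x = 0 := (mem_roots hT0).mp (Multiset.mem_toFinset.mp hx)
      refine abs_le.mp ?_
      refine (Chebyshev.abs_eval_T_real_le_one_iff (n := m) (by exact_mod_cast hm) x).mpr ?_
      rw [← hT, hx']
      simp)
  refine ⟨p, hp, fun x hx => (h x hx).trans ?_⟩
  have hTx : |T.eval x| ≤ 1 := Chebyshev.abs_eval_T_real_le_one m (abs_le.mpr hx)
  rw [hprod, abs_mul, abs_of_pos (by positivity : (0 : ℝ) < 2 ^ (m - 1))] at hTx
  have hM0 : 0 ≤ M := (abs_nonneg _).trans (hM 0 (by norm_num))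
  rw [mul_comm ((2 : ℝ) ^ (m - 1)), ← div_div, div_eq_mul_inv (M / _)]
  refine mul_le_mul_of_nonneg_left ?_ (by positivity)
  rw [← one_div, le_div_iff₀ (by positivity), mul_comm]
  exact hTx

/-- Polynomial approximation of `x ↦ exp (-s x)` on `[0, 2c]`. -/
theorem exists_polynomial_exp_error_le {c s : ℝ} (hc : 0 < c) (hs : 0 ≤ s) (m : ℕ) (hm : m ≠ 0) :
    ∃ p : ℝ[X], p.degree < m ∧ ∀ x ∈ Set.Icc 0 (2 * c),
      |Real.exp (-s * x) - p.eval x| ≤ (s * c) ^ m / (2 ^ (m - 1) * m !) := by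
  have hfc : ContDiff ℝ m fun y => Real.exp (-(s * c) * y) := by fun_prop
  -- Substitute `x = c (1 + y)`. The `m`-th derivative in `y` is `(-sc)^m e^{-sc(1+y)}`, at most
  -- `(sc)^m` in modulus for `y ≥ -1`.
  obtain ⟨p, hp, h⟩ := exists_chebyshev_error_le (M := (s * c) ^ m) m hm
    (fun y => Real.exp (-(s * c)) * Real.exp (-(s * c) * y)) (by fun_prop) (by
      intro ξ hξ
      rw [iteratedDeriv_const_mul_field, iteratedDeriv_exp_const_mul]
      simp only [abs_mul, abs_pow, abs_neg, Real.abs_exp, abs_of_pos hc, abs_of_nonneg hs]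
      have h1 : Real.exp (-(s * c)) * Real.exp (-(s * c) * ξ) ≤ 1 := by
        rw [← Real.exp_add, Real.exp_le_one_iff]
        nlinarith [hξ.1, mul_nonneg hs hc.le]
      calc _ = (s * c) ^ m * (Real.exp (-(s * c)) * Real.exp (-(s * c) * ξ)) := by ring
        _ ≤ (s * c) ^ m * 1 := by gcongr
        _ = _ := mul_one _)
  refine ⟨p.comp (C c⁻¹ * X - 1), ?_, fun x hx => ?_⟩
  · rcases eq_or_ne p 0 with rfl | hp0
    · simp
    · have hpn : p.natDegree < m := (natDegree_lt_iff_degree_lt hp0).mpr hp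
      refine lt_of_le_of_lt degree_le_natDegree ?_
      have h1 : (C c⁻¹ * X - 1 : ℝ[X]).natDegree ≤ 1 := by
        compute_degree
      have h2 := natDegree_comp_le (p := p) (q := C c⁻¹ * X - 1)
      have : (p.comp (C c⁻¹ * X - 1)).natDegree < m := by nlinarith
      exact_mod_cast this
  · have h1 := h (c⁻¹ * x - 1) ⟨by
      have := mul_nonneg (inv_nonneg.mpr hc.le) hx.1
      linarith, by
      have h2 : c⁻¹ * x ≤ c⁻¹ * (2 * c) := mul_le_mul_of_nonneg_left hx.2 (inv_nonneg.mpr hc.le)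
      have h3 : c⁻¹ * (2 * c) = 2 := by field_simp
      linarith⟩
    rw [← Real.exp_add] at h1
    have h2 : -(s * c) + -(s * c) * (c⁻¹ * x - 1) = -s * x := by field_simp; ring
    rw [h2] at h1
    simpa using h1

/-! ### Euclidean norm and spectral decomposition of symmetric matrices -/

theorem norm2_sq {n : ℕ} (x : Fin n → ℝ) : norm2 x ^ 2 = x ⬝ᵥ x := by
  rw [norm2, EuclideanSpace.real_norm_sq_eq]
  simp [dotProduct, sq]

theorem norm2_nonneg {n : ℕ} (x : Fin n → ℝ) : 0 ≤ norm2 x := norm_nonneg _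

theorem norm2_smul {n : ℕ} (a : ℝ) (x : Fin n → ℝ) : norm2 (a • x) = |a| * norm2 x := by
  rw [norm2, WithLp.toLp_smul, norm_smul, Real.norm_eq_abs, norm2]

theorem norm2_eq_zero {n : ℕ} {x : Fin n → ℝ} : norm2 x = 0 ↔ x = 0 := by
  rw [norm2, norm_eq_zero, WithLp.toLp_eq_zero]

/-- A real orthonormal eigenbasis of a symmetric matrix. -/
theorem exists_eigenbasis {k : ℕ} (H : Matrix (Fin k) (Fin k) ℝ) (hH : H.IsSymm) :
    ∃ (u : Fin k → Fin k → ℝ) (l : Fin k → ℝ), (∀ i, H *ᵥ u i = l i • u i) ∧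
      (∀ i, l i ∈ spectrum ℝ H) ∧ (∀ i, u i ⬝ᵥ u i = 1) ∧
      ∀ a b, ∑ i, u i a * u i b = (1 : Matrix (Fin k) (Fin k) ℝ) a b := by
  have hh : H.IsHermitian := by
    rw [Matrix.IsHermitian, Matrix.conjTranspose_eq_transpose_of_trivial]
    exact hH
  refine ⟨fun i => hh.eigenvectorBasis i, hh.eigenvalues, hh.mulVec_eigenvectorBasis,
    hh.eigenvalues_mem_spectrum_real, fun i => ?_, fun a b => ?_⟩
  · have h := hh.eigenvectorBasis.orthonormal.1 i
    rw [← norm2_sq]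
    change ‖hh.eigenvectorBasis i‖ ^ 2 = 1
    rw [h, one_pow]
  · have h := (Matrix.mem_unitaryGroup_iff.mp hh.eigenvectorUnitary.2)
    rw [← h, Matrix.mul_apply]
    simp [Matrix.star_apply]

/-- Expansion of a coordinate vector in an orthonormal basis. -/
theorem sum_apply_smul_eq_single {k : ℕ} {u : Fin k → Fin k → ℝ}
    (hu : ∀ a b, ∑ i, u i a * u i b = (1 : Matrix (Fin k) (Fin k) ℝ) a b) (a : Fin k) :
    ∑ i, u i a • u i = Pi.single a 1 := by
  funext b
  simp [Finset.sum_apply, hu, Matrix.one_apply, Pi.single_apply, eq_comm]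

/-- Parseval's identity. -/
theorem dotProduct_eq_sum {k : ℕ} {u : Fin k → Fin k → ℝ}
    (hu : ∀ a b, ∑ i, u i a * u i b = (1 : Matrix (Fin k) (Fin k) ℝ) a b) (x y : Fin k → ℝ) :
    x ⬝ᵥ y = ∑ i, (u i ⬝ᵥ x) * (u i ⬝ᵥ y) := by
  have h1 : ∀ i, (u i ⬝ᵥ x) * (u i ⬝ᵥ y) = ∑ a, ∑ b, x a * y b * (u i a * u i b) := by
    intro i
    simp only [dotProduct, Finset.sum_mul_sum]
    exact Finset.sum_congr rfl fun a _ => Finset.sum_congr rfl fun b _ => by ring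
  simp only [h1]
  rw [Finset.sum_comm]
  simp only [dotProduct]
  refine Finset.sum_congr rfl fun a _ => ?_
  rw [Finset.sum_comm]
  simp only [← Finset.mul_sum, hu, Matrix.one_apply]
  simp

theorem dotProduct_mulVec_comm {k : ℕ} {H : Matrix (Fin k) (Fin k) ℝ} (hH : H.IsSymm)
    (x y : Fin k → ℝ) : x ⬝ᵥ (H *ᵥ y) = (H *ᵥ x) ⬝ᵥ y := by
  rw [Matrix.dotProduct_mulVec, ← Matrix.mulVec_transpose, hH.eq]

theorem quadraticForm_mem_Icc {n : ℕ} {A : Matrix (Fin n) (Fin n) ℝ} {c : ℝ} (hA : A.IsSymm)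
    (hspec : spectrum ℝ A ⊆ Set.Icc 0 (2 * c)) (x : Fin n → ℝ) :
    x ⬝ᵥ (A *ᵥ x) ∈ Set.Icc 0 (2 * c * (x ⬝ᵥ x)) := by
  obtain ⟨u, l, hl, hls, -, hu⟩ := exists_eigenbasis A hA
  have h1 : x ⬝ᵥ (A *ᵥ x) = ∑ i, l i * (u i ⬝ᵥ x) ^ 2 := by
    rw [dotProduct_eq_sum hu]
    refine Finset.sum_congr rfl fun i _ => ?_
    rw [dotProduct_mulVec_comm hA, hl, smul_dotProduct, smul_eq_mul]
    ring
  rw [h1]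
  refine ⟨Finset.sum_nonneg fun i _ => mul_nonneg (hspec (hls i)).1 (sq_nonneg _), ?_⟩
  rw [dotProduct_eq_sum hu, Finset.mul_sum]
  refine Finset.sum_le_sum fun i _ => ?_
  rw [← sq]
  exact mul_le_mul_of_nonneg_right (hspec (hls i)).2 (sq_nonneg _)

/-- The eigenvalues of `A - cI` lie in `[-c, c]`. Centring the spectrum halves the constant from
`2c` to `c`. -/
theorem norm2_mulVec_sub_smul_le {n : ℕ} {A : Matrix (Fin n) (Fin n) ℝ} {c : ℝ} (hA : A.IsSymm)
    (hc : 0 ≤ c) (hspec : spectrum ℝ A ⊆ Set.Icc 0 (2 * c)) (x : Fin n → ℝ) :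
    norm2 (A *ᵥ x - c • x) ≤ c * norm2 x := by
  obtain ⟨u, l, hl, hls, -, hu⟩ := exists_eigenbasis A hA
  refine abs_le_of_sq_le_sq' ?_ (mul_nonneg hc (norm2_nonneg x)) |>.2
  rw [mul_pow, norm2_sq, norm2_sq, dotProduct_eq_sum hu, dotProduct_eq_sum hu x, Finset.mul_sum]
  refine Finset.sum_le_sum fun i _ => ?_
  have h1 : u i ⬝ᵥ (A *ᵥ x - c • x) = (l i - c) * (u i ⬝ᵥ x) := by
    rw [dotProduct_sub, dotProduct_mulVec_comm hA, hl, smul_dotProduct, dotProduct_smul]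
    simp only [smul_eq_mul]
    ring
  have h2 := hspec (hls i)
  have h3 : (l i - c) ^ 2 ≤ c ^ 2 := sq_le_sq' (by linarith [h2.1]) (by linarith [h2.2])
  rw [h1]
  nlinarith [mul_le_mul_of_nonneg_right h3 (sq_nonneg (u i ⬝ᵥ x))]

/-! ### Polynomials and `φ` on eigenvectors -/

theorem pow_mulVec_eigenvector {k : ℕ} {H : Matrix (Fin k) (Fin k) ℝ} {u : Fin k → ℝ} {l : ℝ}
    (h : H *ᵥ u = l • u) (j : ℕ) : H ^ j *ᵥ u = l ^ j • u := by
  induction j with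
  | zero => simp
  | succ j ih => rw [pow_succ, ← Matrix.mulVec_mulVec, h, Matrix.mulVec_smul, ih, smul_smul,
      pow_succ']

theorem aeval_mulVec_eigenvector {k : ℕ} {H : Matrix (Fin k) (Fin k) ℝ} {u : Fin k → ℝ} {l : ℝ}
    (h : H *ᵥ u = l • u) (p : ℝ[X]) : aeval H p *ᵥ u = p.eval l • u := by
  rw [aeval_eq_sum_range, eval_eq_sum_range, Matrix.sum_mulVec, Finset.sum_smul]
  refine Finset.sum_congr rfl fun j _ => ?_
  rw [Matrix.smul_mulVec, pow_mulVec_eigenvector h, smul_smul]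

theorem phi_mulVec_eigenvector {k : ℕ} {H : Matrix (Fin k) (Fin k) ℝ} {u : Fin k → ℝ} {l : ℝ}
    (h : H *ᵥ u = l • u) : phi H *ᵥ u = phi l • u := by
  -- Evaluation at `u` is a continuous additive map, so it passes through the series.
  have h1 : HasSum (fun j : ℕ => ((((j + 1)! : ℕ) : ℝ)⁻¹ • H ^ j) *ᵥ u) (phi H *ᵥ u) :=
    (hasSum_phi_matrix H).map
      ((Matrix.mulVecBilin ℝ ℝ).flip u).toAddMonoidHom (by
        change Continuous fun M : Matrix (Fin k) (Fin k) ℝ => M *ᵥ u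
        fun_prop)
  refine h1.unique ?_
  have h2 := (summable_phi l).hasSum.smul_const u
  change HasSum _ (phi l • u) at h2
  convert h2 using 2 with j
  rw [Matrix.smul_mulVec, pow_mulVec_eigenvector h, smul_assoc]

theorem mul_phi (x : ℝ) : x * phi x = Real.exp x - 1 := by
  have h1 : HasSum (fun j : ℕ => (((j ! : ℕ) : ℝ))⁻¹ • x ^ j) (Real.exp x) := by
    have h := NormedSpace.exp_series_hasSum_exp' (𝕂 := ℝ) x
    rwa [← Real.exp_eq_exp_ℝ] at h
  have h2 := (hasSum_nat_add_iff' 1).mpr h1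
  have h3 := (summable_phi x).hasSum.mul_left x
  change HasSum _ (x * phi x) at h3
  simp only [mul_smul_comm, ← pow_succ'] at h3
  simpa using h3.unique h2

theorem phi_zero : phi (0 : ℝ) = 1 := by
  have h := hasSum_single (f := fun j : ℕ => (((j + 1)! : ℕ) : ℝ)⁻¹ • (0 : ℝ) ^ j) 0
    (fun j hj => by simp [hj])
  exact h.tsum_eq.trans (by simp)

/-- For `l ≠ 0` the function is `(1 - e^{-sl}) / l`. This lets bounds on the exponential be
integrated to bounds on `t φ(-tH)`. -/
theorem hasDerivAt_mul_phi (l s : ℝ) :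
    HasDerivAt (fun s => s * phi (-s * l)) (Real.exp (-s * l)) s := by
  rcases eq_or_ne l 0 with rfl | hl
  · simp only [mul_zero, phi_zero, mul_one, Real.exp_zero]
    exact hasDerivAt_id s
  · have h1 : (fun s => s * phi (-s * l)) = fun s => (1 - Real.exp (-s * l)) / l := by
      funext s
      rw [eq_div_iff hl]
      linarith [mul_phi (-s * l)]
    rw [h1]
    have h2 : HasDerivAt (fun s : ℝ => -s * l) (-1 * l) s := (hasDerivAt_neg s).mul_const l
    refine ((h2.exp.const_sub 1).div_const l).congr_deriv ?_
    field_simp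

/-! ### Decay of the corner entry for Hessenberg matrices -/

theorem pow_apply_eq_zero_of_hessenberg {k : ℕ} {H : Matrix (Fin k) (Fin k) ℝ}
    (hH : ∀ i j : Fin k, (j : ℕ) + 1 < i → H i j = 0) (z : Fin k) (hz : (z : ℕ) = 0) (j : ℕ) :
    ∀ i : Fin k, j < i → (H ^ j) i z = 0 := by
  induction j with
  | zero =>
    intro i hi
    rw [pow_zero, Matrix.one_apply_ne]
    rintro rfl
    omega
  | succ j ih =>
    intro i hi
    rw [pow_succ', Matrix.mul_apply]
    refine Finset.sum_eq_zero fun a _ => ?_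
    rcases lt_or_ge j (a : ℕ) with ha | ha
    · rw [ih a ha, mul_zero]
    · rw [hH i a (by omega), zero_mul]

/-- Each factor `H` pushes the support of the first column down by at most one row, so a polynomial
of degree below `i` does not reach row `i`. -/
theorem aeval_apply_eq_zero_of_hessenberg {k : ℕ} {H : Matrix (Fin k) (Fin k) ℝ}
    (hH : ∀ i j : Fin k, (j : ℕ) + 1 < i → H i j = 0) (z : Fin k) (hz : (z : ℕ) = 0) (i : Fin k)
    (p : ℝ[X]) (hp : p.degree < (i : ℕ)) : aeval H p i z = 0 := by
  rw [aeval_eq_sum_range, Matrix.sum_apply]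
  refine Finset.sum_eq_zero fun j _ => ?_
  rw [Matrix.smul_apply]
  rcases lt_or_ge j (i : ℕ) with hj | hj
  · rw [pow_apply_eq_zero_of_hessenberg hH z hz j i hj, smul_zero]
  · rw [coeff_eq_zero_of_degree_lt (hp.trans_le (by exact_mod_cast hj)), zero_smul]

/-- An entry of a function of a symmetric matrix is bounded by the largest value on the eigenvalues:
`|xy| ≤ (x² + y²)/2`, and the coordinates `u i a` have squares summing to one over `i`. -/
theorem abs_sum_mul_le {k : ℕ} {u : Fin k → Fin k → ℝ} {d : Fin k → ℝ} {E : ℝ}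
    (hu : ∀ a b, ∑ i, u i a * u i b = (1 : Matrix (Fin k) (Fin k) ℝ) a b)
    (hd : ∀ i, |d i| ≤ E) (a b : Fin k) : |∑ i, u i a * u i b * d i| ≤ E := by
  have h1 : ∀ a, ∑ i, u i a ^ 2 = 1 := fun a => by
    have := hu a a
    rw [Matrix.one_apply_eq] at this
    simpa [sq] using this
  calc |∑ i, u i a * u i b * d i| ≤ ∑ i, |u i a * u i b * d i| := Finset.abs_sum_le_sum_abs _ _
    _ ≤ ∑ i, (u i a ^ 2 + u i b ^ 2) / 2 * E := by
        refine Finset.sum_le_sum fun i _ => ?_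
        rw [abs_mul, abs_mul]
        refine mul_le_mul ?_ (hd i) (abs_nonneg _) (by positivity)
        nlinarith [sq_nonneg (|u i a| - |u i b|), sq_abs (u i a), sq_abs (u i b)]
    _ = E := by
        rw [← Finset.sum_mul, ← Finset.sum_div, Finset.sum_add_distrib, h1, h1]
        ring

/-- The lower left entry of the exponential of a symmetric tridiagonal matrix is small. -/
theorem abs_sum_exp_le {k : ℕ} {H : Matrix (Fin k) (Fin k) ℝ} {u : Fin k → Fin k → ℝ}
    {l : Fin k → ℝ} {c s : ℝ} (hc : 0 < c) (hs : 0 ≤ s) (hl : ∀ i, H *ᵥ u i = l i • u i)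
    (hlc : ∀ i, l i ∈ Set.Icc 0 (2 * c))
    (hu : ∀ a b, ∑ i, u i a * u i b = (1 : Matrix (Fin k) (Fin k) ℝ) a b)
    (hH : ∀ i j : Fin k, (j : ℕ) + 1 < i → H i j = 0) (z m : Fin k) (hz : (z : ℕ) = 0)
    (hm : (m : ℕ) ≠ 0) :
    |∑ i, u i z * u i m * Real.exp (-s * l i)| ≤
      (s * c) ^ (m : ℕ) / (2 ^ ((m : ℕ) - 1) * (m : ℕ)!) := by
  obtain ⟨p, hp, h⟩ := exists_polynomial_exp_error_le hc hs m hm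
  -- This sum is the `(m, z)` entry of `p(H)`, zero since `deg p < m`; hence `p` may be subtracted
  -- from the exponential for free.
  have h0 : ∑ i, u i z * u i m * p.eval (l i) = 0 := by
    have h1 : aeval H p *ᵥ Pi.single z 1 = ∑ i, (u i z * p.eval (l i)) • u i := by
      rw [← sum_apply_smul_eq_single hu z, Matrix.mulVec_sum]
      refine Finset.sum_congr rfl fun i _ => ?_
      rw [Matrix.mulVec_smul, aeval_mulVec_eigenvector (hl i), smul_smul]
    have h2 := congrFun h1 m
    rw [Matrix.mulVec_single_one, Matrix.col_apply,
      aeval_apply_eq_zero_of_hessenberg hH z hz m p hp, Finset.sum_apply] at h2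
    rw [h2]
    refine Finset.sum_congr rfl fun i _ => ?_
    rw [Pi.smul_apply, smul_eq_mul]
    ring
  have h3 : ∑ i, u i z * u i m * Real.exp (-s * l i) =
      ∑ i, u i z * u i m * (Real.exp (-s * l i) - p.eval (l i)) := by
    simp only [mul_sub, Finset.sum_sub_distrib, h0, sub_zero]
  rw [h3]
  exact abs_sum_mul_le hu (fun i => h _ (hlc i)) z m

/-- The lower left entry of `t φ(-t H)` for a symmetric tridiagonal matrix `H`. -/
theorem abs_sum_mul_phi_le {k : ℕ} {H : Matrix (Fin k) (Fin k) ℝ} {u : Fin k → Fin k → ℝ}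
    {l : Fin k → ℝ} {c t : ℝ} (hc : 0 < c) (ht : 0 ≤ t) (hl : ∀ i, H *ᵥ u i = l i • u i)
    (hlc : ∀ i, l i ∈ Set.Icc 0 (2 * c))
    (hu : ∀ a b, ∑ i, u i a * u i b = (1 : Matrix (Fin k) (Fin k) ℝ) a b)
    (hH : ∀ i j : Fin k, (j : ℕ) + 1 < i → H i j = 0) (z m : Fin k) (hz : (z : ℕ) = 0)
    (hm : (m : ℕ) ≠ 0) :
    |∑ i, u i z * u i m * (t * phi (-t * l i))| ≤
      c ^ (m : ℕ) * t ^ ((m : ℕ) + 1) / (2 ^ ((m : ℕ) - 1) * ((m : ℕ) + 1)!) := by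
  have hder : ∀ s, HasDerivAt (fun s => ∑ i, u i z * u i m * (s * phi (-s * l i)))
      (∑ i, u i z * u i m * Real.exp (-s * l i)) s := fun s =>
    HasDerivAt.fun_sum fun i _ => (hasDerivAt_mul_phi (l i) s).const_mul _
  have hB : ∀ s : ℝ, HasDerivAt
      (fun s => c ^ (m : ℕ) * s ^ ((m : ℕ) + 1) / (2 ^ ((m : ℕ) - 1) * ((m : ℕ) + 1)!))
      ((s * c) ^ (m : ℕ) / (2 ^ ((m : ℕ) - 1) * (m : ℕ)!)) s := by
    intro s
    have h := ((hasDerivAt_pow ((m : ℕ) + 1) s).const_mul (c ^ (m : ℕ))).div_const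
      ((2 : ℝ) ^ ((m : ℕ) - 1) * ((m : ℕ) + 1)!)
    refine h.congr_deriv ?_
    have : (0 : ℝ) < (m : ℕ)! := by exact_mod_cast Nat.factorial_pos _
    rw [Nat.factorial_succ]
    push_cast
    rw [mul_pow]
    field_simp
  -- Both sides vanish at `s = 0`, so the inequality between the derivatives integrates.
  exact image_norm_le_of_norm_deriv_right_le_deriv_boundary (a := 0) (b := t)
    (fun s _ => (hder s).continuousAt.continuousWithinAt)
    (fun s _ => (hder s).hasDerivWithinAt) (by simp)
    hB (fun s hs => abs_sum_exp_le hc hs.1 hl hlc hu hH z m hz hm) ⟨ht, le_rfl⟩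

/-! ### The Arnoldi process -/

section

variable {n : ℕ} (A : Matrix (Fin n) (Fin n) ℝ) (b : Fin n → ℝ)

/-- The vector `w_j` of the Arnoldi process, before normalization. -/
def arnoldiResid (j : ℕ) : Fin n → ℝ :=
  A *ᵥ arnoldiVec A b j -
    ∑ i : Fin (j + 1),
      (arnoldiVec A b (i : ℕ) ⬝ᵥ (A *ᵥ arnoldiVec A b j)) • arnoldiVec A b (i : ℕ)

theorem arnoldiVec_zero : arnoldiVec A b 0 = (norm2 b)⁻¹ • b := by
  rw [arnoldiVec]

theorem arnoldiVec_succ (j : ℕ) :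
    arnoldiVec A b (j + 1) = (norm2 (arnoldiResid A b j))⁻¹ • arnoldiResid A b j := by
  rw [arnoldiVec]
  rfl

/-- At termination both sides are zero, so no case distinction is needed later. -/
theorem norm2_smul_arnoldiVec_succ (j : ℕ) :
    norm2 (arnoldiResid A b j) • arnoldiVec A b (j + 1) = arnoldiResid A b j := by
  rw [arnoldiVec_succ]
  by_cases h : norm2 (arnoldiResid A b j) = 0
  · rw [h, zero_smul, norm2_eq_zero.mp h]
  · rw [smul_inv_smul₀ h]

theorem normalize_eq_zero_or {n : ℕ} (x : Fin n → ℝ) :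
    (norm2 x)⁻¹ • x = 0 ∨ norm2 ((norm2 x)⁻¹ • x) = 1 := by
  by_cases h : norm2 x = 0
  · left
    rw [h, inv_zero, zero_smul]
  · right
    rw [norm2_smul, abs_of_nonneg (inv_nonneg.mpr (norm2_nonneg x)), inv_mul_cancel₀ h]

/-- Stands in for normalization, since the vectors after termination are zero. -/
theorem arnoldiVec_eq_zero_or (j : ℕ) : arnoldiVec A b j = 0 ∨ norm2 (arnoldiVec A b j) = 1 := by
  cases j with
  | zero => rw [arnoldiVec_zero]; exact normalize_eq_zero_or _
  | succ j => rw [arnoldiVec_succ]; exact normalize_eq_zero_or _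

/-- Induction on the later index: the Gram–Schmidt subtraction cancels the component along a unit
`v_i`, and a zero `v_i` is harmless. -/
theorem arnoldiVec_dotProduct_of_lt (j : ℕ) :
    ∀ i < j, arnoldiVec A b i ⬝ᵥ arnoldiVec A b j = 0 := by
  induction j using Nat.strong_induction_on with
  | _ j ih =>
    intro i hi
    obtain ⟨j, rfl⟩ : ∃ j', j = j' + 1 := ⟨j - 1, by omega⟩
    suffices h : arnoldiVec A b i ⬝ᵥ arnoldiResid A b j = 0 by
      rw [arnoldiVec_succ, dotProduct_smul, h, smul_zero]
    rw [arnoldiResid, dotProduct_sub, dotProduct_sum, Finset.sum_eq_single (⟨i, hi⟩ : Fin (j + 1))]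
    · rcases arnoldiVec_eq_zero_or A b i with h | h
      · simp [h]
      · rw [dotProduct_smul, ← norm2_sq, h]
        simp
    · intro a _ ha
      have ha' : (a : ℕ) ≠ i := fun h => ha (Fin.ext h)
      rw [dotProduct_smul]
      rcases lt_or_gt_of_ne ha' with h | h
      · rw [dotProduct_comm (arnoldiVec A b i), ih i hi a h, smul_zero]
      · rw [ih a a.2 i h, smul_zero]
    · simp

theorem arnoldiVec_dotProduct_of_ne {i j : ℕ} (h : i ≠ j) :
    arnoldiVec A b i ⬝ᵥ arnoldiVec A b j = 0 := by
  rcases lt_or_gt_of_ne h with h | h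
  · exact arnoldiVec_dotProduct_of_lt A b j i h
  · rw [dotProduct_comm]
    exact arnoldiVec_dotProduct_of_lt A b i j h

theorem arnoldiVec_dotProduct_self_smul (i : ℕ) :
    (arnoldiVec A b i ⬝ᵥ arnoldiVec A b i) • arnoldiVec A b i = arnoldiVec A b i := by
  rcases arnoldiVec_eq_zero_or A b i with h | h
  · simp [h]
  · rw [← norm2_sq, h]
    simp

/-- The Hessenberg structure of the Arnoldi process. -/
theorem arnoldiVec_dotProduct_mulVec {i j : ℕ} (h : j < i) :
    arnoldiVec A b i ⬝ᵥ (A *ᵥ arnoldiVec A b j) =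
      arnoldiVec A b i ⬝ᵥ arnoldiResid A b j := by
  rw [arnoldiResid, dotProduct_sub, dotProduct_sum, Finset.sum_eq_zero, sub_zero]
  intro a _
  rw [dotProduct_smul, arnoldiVec_dotProduct_of_ne A b (by omega), smul_zero]

theorem arnoldiVec_dotProduct_mulVec_eq_zero {i j : ℕ} (h : j + 1 < i) :
    arnoldiVec A b i ⬝ᵥ (A *ᵥ arnoldiVec A b j) = 0 := by
  rw [arnoldiVec_dotProduct_mulVec A b (by omega), ← norm2_smul_arnoldiVec_succ, dotProduct_smul,
    arnoldiVec_dotProduct_of_ne A b (by omega), smul_zero]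

theorem arnoldiV_mulVec (k : ℕ) (x : Fin k → ℝ) :
    arnoldiV A b k *ᵥ x = ∑ i : Fin k, x i • arnoldiVec A b i := by
  funext a
  simp [Matrix.mulVec, dotProduct, arnoldiV, Finset.sum_apply, mul_comm]

theorem arnoldiH_apply (k : ℕ) (i j : Fin k) :
    arnoldiH A b k i j = arnoldiVec A b i ⬝ᵥ (A *ᵥ arnoldiVec A b j) := by
  rw [arnoldiH, Matrix.mul_assoc, Matrix.mul_apply]
  rfl

theorem arnoldiH_isSymm (hA : A.IsSymm) (k : ℕ) : (arnoldiH A b k).IsSymm := by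
  rw [Matrix.IsSymm, arnoldiH]
  simp only [Matrix.transpose_mul, Matrix.transpose_transpose, hA.eq, Matrix.mul_assoc]

theorem arnoldiH_hessenberg (k : ℕ) (i j : Fin k) (h : (j : ℕ) + 1 < i) :
    arnoldiH A b k i j = 0 := by
  rw [arnoldiH_apply, arnoldiVec_dotProduct_mulVec_eq_zero A b h]

/-- The matrix `V_k` does not increase the norm. -/
theorem dotProduct_arnoldiV_mulVec_le (k : ℕ) (x : Fin k → ℝ) :
    (arnoldiV A b k *ᵥ x) ⬝ᵥ (arnoldiV A b k *ᵥ x) ≤ x ⬝ᵥ x := by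
  rw [arnoldiV_mulVec, sum_dotProduct]
  refine Finset.sum_le_sum fun i _ => ?_
  rw [dotProduct_sum, Finset.sum_eq_single i]
  · rw [smul_dotProduct, dotProduct_smul, smul_eq_mul, smul_eq_mul, ← mul_assoc]
    rcases arnoldiVec_eq_zero_or A b i with h | h
    · rw [h, dotProduct_zero, mul_zero]
      exact mul_self_nonneg _
    · rw [← norm2_sq, h, one_pow, mul_one]
  · intro j _ hj
    rw [smul_dotProduct, dotProduct_smul,
      arnoldiVec_dotProduct_of_ne A b fun h => hj (Fin.ext h.symm), smul_zero, smul_zero]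
  · simp

theorem dotProduct_arnoldiH_mulVec (k : ℕ) (x : Fin k → ℝ) :
    x ⬝ᵥ (arnoldiH A b k *ᵥ x) =
      (arnoldiV A b k *ᵥ x) ⬝ᵥ (A *ᵥ (arnoldiV A b k *ᵥ x)) := by
  rw [arnoldiH, ← Matrix.mulVec_mulVec, ← Matrix.mulVec_mulVec, Matrix.dotProduct_mulVec,
    Matrix.vecMul_transpose]

/-- The Arnoldi relation `A V_{k+1} = V_{k+1} H_{k+1} + w_{k+1} e_{k+1}ᵀ`. -/
theorem mulVec_arnoldiV_mulVec (k : ℕ) (x : Fin (k + 1) → ℝ) :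
    A *ᵥ (arnoldiV A b (k + 1) *ᵥ x) =
      arnoldiV A b (k + 1) *ᵥ (arnoldiH A b (k + 1) *ᵥ x) +
        x (Fin.last k) • arnoldiResid A b k := by
  -- Column by column: for `j < k` the subdiagonal term `i = j + 1` reproduces `w_j` and the terms
  -- below vanish. In the last column there is no such row, so `w_k` is left over.
  have hcol : ∀ j : Fin (k + 1), A *ᵥ arnoldiVec A b j =
      ∑ i : Fin (k + 1), arnoldiH A b (k + 1) i j • arnoldiVec A b i +
        if j = Fin.last k then arnoldiResid A b k else 0 := by
    intro j
    have h1 : A *ᵥ arnoldiVec A b j = arnoldiResid A b j +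
        ∑ i ∈ Finset.range ((j : ℕ) + 1),
          (arnoldiVec A b i ⬝ᵥ (A *ᵥ arnoldiVec A b j)) • arnoldiVec A b i := by
      rw [arnoldiResid, Finset.sum_range, sub_add_cancel]
    simp only [arnoldiH_apply]
    rw [← Finset.sum_range fun i => (arnoldiVec A b i ⬝ᵥ (A *ᵥ arnoldiVec A b j)) •
      arnoldiVec A b i]
    split_ifs with hj
    · subst hj
      conv_lhs => rw [h1, add_comm]
      simp only [Fin.val_last]
    · have hjk : (j : ℕ) + 1 ≤ k := by
        have := j.2
        have : (j : ℕ) ≠ k := fun h => hj (Fin.ext h)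
        omega
      rw [add_zero, ← Finset.sum_range_add_sum_Ico _ (show (j : ℕ) + 2 ≤ k + 1 by omega),
        Finset.sum_range_succ, Finset.sum_eq_zero (s := Finset.Ico _ _), add_zero]
      · rw [arnoldiVec_dotProduct_mulVec A b (Nat.lt_succ_self (j : ℕ)),
          ← norm2_smul_arnoldiVec_succ A b j, dotProduct_smul, smul_assoc,
          arnoldiVec_dotProduct_self_smul, norm2_smul_arnoldiVec_succ]
        conv_lhs => rw [h1, add_comm]
      · intro i hi
        rw [arnoldiVec_dotProduct_mulVec_eq_zero A b (by
          have := (Finset.mem_Ico.mp hi).1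
          omega), zero_smul]
  rw [arnoldiV_mulVec, arnoldiV_mulVec, Matrix.mulVec_sum]
  simp only [Matrix.mulVec_smul, hcol, smul_add, Finset.sum_add_distrib, smul_ite, smul_zero,
    Finset.sum_ite_eq', Finset.mem_univ, if_true]
  congr 1
  simp only [Finset.smul_sum]
  rw [Finset.sum_comm]
  refine Finset.sum_congr rfl fun i _ => ?_
  rw [Matrix.mulVec, dotProduct, Finset.sum_smul]
  refine Finset.sum_congr rfl fun j _ => ?_
  rw [smul_smul, mul_comm]

/-- The subdiagonal coefficients of the Arnoldi process are at most `c`. -/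
theorem norm2_arnoldiResid_le {c : ℝ} (hA : A.IsSymm) (hc : 0 ≤ c)
    (hspec : spectrum ℝ A ⊆ Set.Icc 0 (2 * c)) (j : ℕ) : norm2 (arnoldiResid A b j) ≤ c := by
  set q := arnoldiVec A b (j + 1) with hq
  set w := arnoldiResid A b j with hw
  -- The vector `q` is the normalized `w` and is orthogonal to `v_j`, so subtracting `c v_j` changes
  -- nothing.
  have h1 : norm2 w = q ⬝ᵥ (A *ᵥ arnoldiVec A b j - c • arnoldiVec A b j) := by
    rw [dotProduct_sub, dotProduct_smul, hq, arnoldiVec_dotProduct_of_ne A b (by omega),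
      smul_zero, sub_zero, arnoldiVec_dotProduct_mulVec A b (Nat.lt_succ_self j), ← hw,
      arnoldiVec_succ, ← hw, smul_dotProduct, ← norm2_sq, smul_eq_mul]
    by_cases h : norm2 w = 0
    · simp [h]
    · field_simp
  have hle : ∀ i, norm2 (arnoldiVec A b i) ≤ 1 := fun i => by
    rcases arnoldiVec_eq_zero_or A b i with h | h
    · rw [norm2_eq_zero.mpr h]
      exact zero_le_one
    · exact h.le
  rw [h1]
  have h2 := real_inner_le_norm (WithLp.toLp 2 (A *ᵥ arnoldiVec A b j - c • arnoldiVec A b j))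
    (WithLp.toLp 2 q)
  rw [EuclideanSpace.inner_toLp_toLp, star_trivial] at h2
  refine h2.trans ?_
  have h3 := norm2_mulVec_sub_smul_le hA hc hspec (arnoldiVec A b j)
  have h4 : c * norm2 (arnoldiVec A b j) ≤ c := by
    simpa using mul_le_mul_of_nonneg_left (hle j) hc
  exact (mul_le_of_le_one_right (norm_nonneg _) (hle _)).trans (h3.trans h4)

end

/-- A unit eigenvector makes `l` the quadratic form of `A` at `V u`, and `V` does not lengthen `u`.
Zero columns of `V` after termination only add the eigenvalue `0`, which the interval contains. -/
theorem mem_Icc_of_arnoldiH_eigenvector {n : ℕ} {A : Matrix (Fin n) (Fin n) ℝ} (b : Fin n → ℝ)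
    {c : ℝ} (hA : A.IsSymm) (hc : 0 < c) (hspec : spectrum ℝ A ⊆ Set.Icc 0 (2 * c)) {k : ℕ}
    {u : Fin k → ℝ} {l : ℝ} (hu : u ⬝ᵥ u = 1) (hl : arnoldiH A b k *ᵥ u = l • u) :
    l ∈ Set.Icc 0 (2 * c) := by
  have h1 : l = (arnoldiV A b k *ᵥ u) ⬝ᵥ (A *ᵥ (arnoldiV A b k *ᵥ u)) := by
    rw [← dotProduct_arnoldiH_mulVec, hl, dotProduct_smul, hu, smul_eq_mul, mul_one]
  have h2 := quadraticForm_mem_Icc hA hspec (arnoldiV A b k *ᵥ u)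
  have h3 := dotProduct_arnoldiV_mulVec_le A b k u
  rw [hu] at h3
  rw [← h1] at h2
  exact ⟨h2.1, h2.2.trans (mul_le_of_le_one_right (by positivity) h3)⟩

/-! ### The Krylov approximation and its residual -/

theorem e1_eq_single (K : ℕ) : e1 (K + 1) = Pi.single 0 1 := by
  funext i
  by_cases h : i = 0
  · rw [h, Pi.single_eq_same, e1, if_pos (Fin.val_zero _)]
  · rw [Pi.single_eq_of_ne h]
    exact if_neg fun h' => h (Fin.ext h')

section

variable {n : ℕ} {A : Matrix (Fin n) (Fin n) ℝ} {g v : Fin n → ℝ} {K : ℕ}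
  {u : Fin (K + 1) → Fin (K + 1) → ℝ} {l : Fin (K + 1) → ℝ}

/-- The Krylov approximation in the eigenbasis of `H_k`. -/
theorem krylovApprox_eq_sum (hβ : norm2 (g - A *ᵥ v) = 1)
    (hl : ∀ i, arnoldiH A (g - A *ᵥ v) (K + 1) *ᵥ u i = l i • u i)
    (hu : ∀ a b, ∑ i, u i a * u i b = (1 : Matrix (Fin (K + 1)) (Fin (K + 1)) ℝ) a b) (s : ℝ) :
    krylovApprox A g v (K + 1) s = v + arnoldiV A (g - A *ᵥ v) (K + 1) *ᵥ
      ∑ i, (u i 0 * (s * phi (-s * l i))) • u i := by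
  rw [krylovApprox, hβ, one_smul, e1_eq_single, ← sum_apply_smul_eq_single hu, Matrix.mulVec_sum,
    Finset.smul_sum]
  congr 2
  refine Finset.sum_congr rfl fun i _ => ?_
  have h : (-s • arnoldiH A (g - A *ᵥ v) (K + 1)) *ᵥ u i = (-s * l i) • u i := by
    rw [Matrix.smul_mulVec, hl, smul_smul]
  rw [Matrix.mulVec_smul, phi_mulVec_eigenvector h, smul_smul, smul_smul]
  congr 1
  ring

theorem hasDerivAt_krylovApprox (hβ : norm2 (g - A *ᵥ v) = 1)
    (hl : ∀ i, arnoldiH A (g - A *ᵥ v) (K + 1) *ᵥ u i = l i • u i)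
    (hu : ∀ a b, ∑ i, u i a * u i b = (1 : Matrix (Fin (K + 1)) (Fin (K + 1)) ℝ) a b) (s : ℝ) :
    HasDerivAt (krylovApprox A g v (K + 1)) (arnoldiV A (g - A *ᵥ v) (K + 1) *ᵥ
      ∑ i, (u i 0 * Real.exp (-s * l i)) • u i) s := by
  rw [funext (krylovApprox_eq_sum hβ hl hu)]
  refine HasDerivAt.const_add _ ?_
  have h : HasDerivAt (fun s => ∑ i, (u i 0 * (s * phi (-s * l i))) • u i)
      (∑ i, (u i 0 * Real.exp (-s * l i)) • u i) s :=
    HasDerivAt.fun_sum fun i _ => ((hasDerivAt_mul_phi (l i) s).const_mul _).smul_const _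
  exact (LinearMap.toContinuousLinearMap
    (Matrix.mulVecLin (arnoldiV A (g - A *ᵥ v) (K + 1)))).hasFDerivAt.comp_hasDerivAt s h

/-- The residual is a multiple of the next Arnoldi vector. -/
theorem krylovResidual_eq (hβ : norm2 (g - A *ᵥ v) = 1)
    (hl : ∀ i, arnoldiH A (g - A *ᵥ v) (K + 1) *ᵥ u i = l i • u i)
    (hu : ∀ a b, ∑ i, u i a * u i b = (1 : Matrix (Fin (K + 1)) (Fin (K + 1)) ℝ) a b) (t : ℝ) :
    krylovResidual A g v (K + 1) t =
      -(∑ i, u i 0 * u i (Fin.last K) * (t * phi (-t * l i))) •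
        arnoldiResid A (g - A *ᵥ v) K := by
  -- In matrix form `H t φ(-tH) e₁ + e^{-tH} e₁ = e₁`, from `x φ(x) = e^x - 1` at `x = -t l i`.
  have hE : arnoldiH A (g - A *ᵥ v) (K + 1) *ᵥ (∑ i, (u i 0 * (t * phi (-t * l i))) • u i) +
      ∑ i, (u i 0 * Real.exp (-t * l i)) • u i = Pi.single 0 1 := by
    rw [← sum_apply_smul_eq_single hu, Matrix.mulVec_sum, ← Finset.sum_add_distrib]
    refine Finset.sum_congr rfl fun i _ => ?_
    rw [Matrix.mulVec_smul, hl, smul_smul, ← add_smul]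
    congr 1
    linear_combination -u i 0 * mul_phi (-t * l i)
  have hV : arnoldiV A (g - A *ᵥ v) (K + 1) *ᵥ Pi.single 0 1 = g - A *ᵥ v := by
    rw [arnoldiV_mulVec, Finset.sum_eq_single 0]
    · rw [Pi.single_eq_same, one_smul, Fin.val_zero, arnoldiVec_zero, hβ, inv_one, one_smul]
    · intro j _ hj
      rw [Pi.single_eq_of_ne hj, zero_smul]
    · simp
  have hz : (∑ i, (u i 0 * (t * phi (-t * l i))) • u i) (Fin.last K) =
      ∑ i, u i 0 * u i (Fin.last K) * (t * phi (-t * l i)) := by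
    rw [Finset.sum_apply]
    refine Finset.sum_congr rfl fun i _ => ?_
    rw [Pi.smul_apply, smul_eq_mul]
    ring
  -- By the Arnoldi relation the residual is `(g - A v) - V (H z + z') - z_last w`, with `z = t
  -- φ(-tH) e₁`. The first two terms cancel by `hE` and `hV`.
  rw [krylovResidual, (hasDerivAt_krylovApprox hβ hl hu t).deriv, krylovApprox_eq_sum hβ hl hu,
    Matrix.mulVec_add, mulVec_arnoldiV_mulVec, hz, neg_smul]
  rw [← hE, Matrix.mulVec_add] at hV
  rw [sub_eq_add_neg, add_comm (A *ᵥ v)]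
  linear_combination (exp := 1) -hV

end

/-! ### Constants and the final bound -/

theorem doubleFactorial_le_two_pow_mul_factorial (k : ℕ) :
    (2 * (k + 1) - 1)‼ ≤ 2 ^ (k + 1) * (k + 1)! := by
  -- The right side is `(2k+2)‼`, which is compared with `(2k+1)‼` factor by factor.
  rw [← Nat.doubleFactorial_two_mul]
  induction k with
  | zero => decide
  | succ k ih =>
    rw [show 2 * (k + 1 + 1) - 1 = (2 * (k + 1) - 1) + 2 by omega,
      show 2 * (k + 1 + 1) = 2 * (k + 1) + 2 by omega, Nat.doubleFactorial_add_two,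
      Nat.doubleFactorial_add_two]
    exact Nat.mul_le_mul (by omega) ih

/-- The residual bound without restriction on the size of `k ≥ 2`. -/
theorem norm2_krylovResidual_le {n : ℕ} {A : Matrix (Fin n) (Fin n) ℝ} {g v : Fin n → ℝ} {c t : ℝ}
    {K : ℕ} (hA : A.IsSymm) (hc : 0 < c) (hspec : spectrum ℝ A ⊆ Set.Icc 0 (2 * c))
    (hβ : norm2 (g - A *ᵥ v) = 1) (ht : 0 ≤ t) (hK : K ≠ 0) :
    DifferentiableAt ℝ (krylovApprox A g v (K + 1)) t ∧
      norm2 (krylovResidual A g v (K + 1) t) ≤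
        4 * (c * t) ^ (K + 1) / (2 ^ (K + 1) * (K + 1)!) := by
  obtain ⟨u, l, hl, -, hu1, hu⟩ := exists_eigenbasis _ (arnoldiH_isSymm A (g - A *ᵥ v) hA (K + 1))
  refine ⟨(hasDerivAt_krylovApprox hβ hl hu t).differentiableAt, ?_⟩
  have hlc : ∀ i, l i ∈ Set.Icc 0 (2 * c) := fun i =>
    mem_Icc_of_arnoldiH_eigenvector _ hA hc hspec (hu1 i) (hl i)
  have h1 := abs_sum_mul_phi_le hc ht hl hlc hu (arnoldiH_hessenberg A _ (K + 1)) 0 (Fin.last K)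
    rfl hK
  rw [Fin.val_last] at h1
  rw [krylovResidual_eq hβ hl hu, norm2_smul, abs_neg]
  refine (mul_le_mul h1 (norm2_arnoldiResid_le A _ hA hc.le hspec K) (norm2_nonneg _)
    ((abs_nonneg _).trans h1)).trans_eq ?_
  -- Writing `K = m + 1` removes the truncated subtraction in `2^(K-1)`; the constant is `4 =
  -- 2^(K+1) / 2^(K-1)`.
  obtain ⟨m, rfl⟩ := Nat.exists_eq_succ_of_ne_zero hK
  rw [Nat.succ_sub_one, mul_pow, Nat.succ_eq_add_one]
  field_simp
  ring

end KrylovPhi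

end

/-- The residual bound for `k` of order at least `ct` in the symmetric case, under the
normalization `β = ‖g - A v‖ = 1`. The first conjunct says that the derivative in the residual
is a true derivative. -/
theorem propositionP3 {n : ℕ} (A : Matrix (Fin n) (Fin n) ℝ) (g v : Fin n → ℝ) (c t : ℝ) (k : ℕ)
    (hA : A.IsSymm) (hc : 0 < c) (hspec : spectrum ℝ A ⊆ Set.Icc 0 (2 * c))
    (hβ : KrylovPhi.norm2 (g - A *ᵥ v) = 1)
    (ht : 0 ≤ t) (hk : max (5 * c * t) 2 ≤ (k : ℝ)) :
    DifferentiableAt ℝ (KrylovPhi.krylovApprox A g v k) t ∧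
      KrylovPhi.norm2 (KrylovPhi.krylovResidual A g v k t) ≤
        16 * (c * t) ^ k / ((2 * k - 1)‼ : ℕ) := by
  have hk2 : 2 ≤ k := by exact_mod_cast (le_max_right _ _).trans hk
  obtain ⟨K, rfl⟩ : ∃ K, k = K + 1 := ⟨k - 1, by omega⟩
  obtain ⟨h1, h2⟩ := KrylovPhi.norm2_krylovResidual_le hA hc hspec hβ ht (K := K) (by omega)
  refine ⟨h1, h2.trans ?_⟩
  have h3 : (((2 * (K + 1) - 1)‼ : ℕ) : ℝ) ≤ 2 ^ (K + 1) * (K + 1)! := by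
    exact_mod_cast KrylovPhi.doubleFactorial_le_two_pow_mul_factorial K
  have h4 : (0 : ℝ) < ((2 * (K + 1) - 1)‼ : ℕ) := by
    exact_mod_cast Nat.doubleFactorial_pos _
  -- Enlarging the denominator by `h3` leaves only `4 ≤ 16`.
  gcongr
  norm_num
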